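/- Let $\mathcal D$ be a probability distribution on $\mathbb R^n$ with finite second moment. For $i$ in a finite index set, let $(A,B,Q_i,R_i)$ be LQR tasks with common dynamics $A\in\mathbb R^{n\times n}$, $0\ne B\in\mathbb R^{n\times m}$ and with symmetric positive definite cost matrices $Q_i\in\mathbb R^{n\times n}$, $R_i\in\mathbb R^{m\times m}$. Let $(p_i)$ be a probability distribution on the tasks, and write $\mathbb E_i$ for the expectation over $i\sim p$. Let $\|\cdot\|$ be the largest singular value of a matrix (and the operator norm it induces for linear operators on $\mathbb R^{m\times n}$), $\|\cdot\|_F$ the Frobenius norm, and $\sigma_{\min}$ the smallest singular value. A parameter $W\in\mathbb R^{m\times n}$ is stabilizing if the spectral radius of $A-BW$ is less than $1$. Its cost for task $i$ is $$C_i(W)=\mathbb E_{x_0\sim\mathcal D}\Big[\sum_{t\ge 0}x_t^T(Q_i+W^TR_iW)x_t\Big],\qquad x_{t+1}=(A-BW)x_t .$$ Gradients are taken with respect to $\langle X,Y\rangle=\mathrm{tr}(X^TY)$, and $\nabla^2C_i(W)$ denotes the Hessian operator on $\mathbb R^{m\times n}$. Put $\mu=\sigma_{\min}(\mathbb E[x_0x_0^T])$,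 $$\delta(W)=\min_i\frac{\sigma_{\min}(Q_i)\,\mu}{4\,C_i(W)\,\|B\|\,(\|A-BW\|+1)},\qquad F(W)=\mathbb E_i\big[C_i(W-\eta\nabla C_i(W))\big].$$ Let $W$ be stabilizing and let $\eta>0$ satisfy $\eta\,\|\nabla C_i(W)\|<\delta(W)$ for all $i$. Let $\mathcal A$ be the set of all stabilizing $U$ such that $\|U-W\|\le\delta(W)$ and $\eta\,\|\nabla C_i(U)\|<\delta(U)$ for all $i$. For a set $\mathcal U\subseteq\mathcal A$, consider the following constants. * $\ell_i,\rho_i\ge 0$ are Lipschitz constants at $W$ on the ball of radius $\delta(W)$: for all $V$ with $\|V-W\|\le\delta(W)$, $\|\nabla C_i(V)-\nabla C_i(W)\|\le\ell_i\|V-W\|$ and $\|\nabla^2C_i(V)-\nabla^2C_i(W)\|\le\rho_i\|V-W\|$. * $\bar\ell_i\ge 0$ is a Lipschitz constant of $\nabla C_i$ at the adapted parameter $\tilde W_i=W-\eta\nabla C_i(W)$, relative to the adapted parameters $\tilde U_i=U-\eta\nabla C_i(U)$, $U\in\mathcal U$: $\|\nabla C_i(\tilde U_i)-\nabla C_i(\tilde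 W_i)\|\le\bar\ell_i\|\tilde U_i-\tilde W_i\|$ for all $U\in\mathcal U$. * $H_i\in\mathbb R^{nm\times nm}$ is a mean-value matrix: $\mathrm{vec}(\nabla C_i(\tilde W_i)-\nabla C_i(W))=H_i\,\mathrm{vec}(\tilde W_i-W)$. Then such constants exist, even for $\mathcal U=\mathcal A$. Moreover, for every $\mathcal U\subseteq\mathcal A$ and every choice of such constants, with $\ell=\max_i\ell_i$, $\bar\ell=\max_i\bar\ell_i$, $\rho=\max_i\rho_i$, $\|H\|=\max_i\|H_i\|$, the function $F$ is differentiable at $W$ and at every $U\in\mathcal U$, and $$\|\nabla F(U)-\nabla F(W)\|\le L(W)\,\|U-W\|\qquad\text{for all }U\in\mathcal U,$$ $$L(W)=\bar\ell\,\big(1+\eta(\ell+\delta(W)\rho)\big)(1+\eta\ell)+\eta\,\rho\,(1+\eta\|H\|)\;\mathbb E_i\big[\|\nabla C_i(W)\|_F\big].$$ -/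

import Mathlib

open MeasureTheory
open scoped Matrix Matrix.Norms.L2Operator

/-! In this file `‖Z‖` for a real matrix `Z` is its largest singular value (the `ℓ²` operator norm),
and the norm of a continuous linear map between spaces of matrices is the operator norm induced by
it. -/

noncomputable section

/-- The Frobenius norm of a matrix. -/
def frobNorm {m n : ℕ} (Z : Matrix (Fin m) (Fin n) ℝ) : ℝ :=
  Real.sqrt (∑ i, ∑ j, Z i j ^ 2)

/-- The smallest singular value of a square matrix. -/
def sigmaMin {n : ℕ} (Z : Matrix (Fin n) (Fin n) ℝ) : ℝ :=
  ⨅ i : Fin n, (Matrix.toEuclideanLin Z).singularValues i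

/-- The gradient, with respect to the inner product `⟨X, Y⟩ = tr (Xᵀ Y)`, of a real function of
a matrix: the matrix of its partial derivatives. -/
def matGrad {m n : ℕ} (f : Matrix (Fin m) (Fin n) ℝ → ℝ) (W : Matrix (Fin m) (Fin n) ℝ) :
    Matrix (Fin m) (Fin n) ℝ :=
  Matrix.of fun i j => fderiv ℝ f W (Matrix.single i j 1)

/-- The Hessian operator `Y ↦ ∇²f(W)[Y]`, the derivative of the gradient. -/
def matHess {m n : ℕ} (f : Matrix (Fin m) (Fin n) ℝ → ℝ) (W : Matrix (Fin m) (Fin n) ℝ) :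
    Matrix (Fin m) (Fin n) ℝ →L[ℝ] Matrix (Fin m) (Fin n) ℝ :=
  fderiv ℝ (matGrad f) W

/-- The matrix `𝔼[x₀ x₀ᵀ]` of the initial state distribution. -/
def secondMoment {n : ℕ} (D : Measure (Fin n → ℝ)) : Matrix (Fin n) (Fin n) ℝ :=
  Matrix.of fun i j => ∫ x, x i * x j ∂D

/-- An LQR task `(A, B, Q, R)` with `n` states and `m` inputs. -/
structure LQRTask (n m : ℕ) where
  A : Matrix (Fin n) (Fin n) ℝ
  B : Matrix (Fin n) (Fin m) ℝ
  Q : Matrix (Fin n) (Fin n) ℝ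
  R : Matrix (Fin m) (Fin m) ℝ
  Q_posDef : Q.PosDef
  R_posDef : R.PosDef

namespace LQRTask

variable {n m : ℕ}

/-- The closed-loop state: `x_{t+1} = A x_t + B u_t` with the policy `u_t = - W x_t`. -/
def state (T : LQRTask n m) (W : Matrix (Fin m) (Fin n) ℝ) (x₀ : Fin n → ℝ) : ℕ → Fin n → ℝ
  | 0 => x₀
  | t + 1 => T.A *ᵥ T.state W x₀ t + T.B *ᵥ (-(W *ᵥ T.state W x₀ t))

/-- The LQR cost `C(W) = 𝔼 ∑ₜ xₜᵀ (Q + Wᵀ R W) xₜ`. It is only used at (and near) stabilizing `W`,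
where the series converges. -/
def cost (D : Measure (Fin n → ℝ)) (T : LQRTask n m) (W : Matrix (Fin m) (Fin n) ℝ) : ℝ :=
  ∫ x₀, ∑' t : ℕ, T.state W x₀ t ⬝ᵥ ((T.Q + Wᵀ * T.R * W) *ᵥ T.state W x₀ t) ∂D

/-- `W` is task-stabilizing: the (complex) spectral radius of `A - B W` is less than one. -/
def IsStabilizing (T : LQRTask n m) (W : Matrix (Fin m) (Fin n) ℝ) : Prop :=
  spectralRadius ℂ ((T.A - T.B * W).map (algebraMap ℝ ℂ)) < 1

/-- The gradient `∇C(W)` of the LQR cost. -/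
def grad (D : Measure (Fin n → ℝ)) (T : LQRTask n m) (W : Matrix (Fin m) (Fin n) ℝ) :
    Matrix (Fin m) (Fin n) ℝ :=
  matGrad (T.cost D) W

/-- The Hessian operator `∇²C(W)` of the LQR cost. -/
def hess (D : Measure (Fin n → ℝ)) (T : LQRTask n m) (W : Matrix (Fin m) (Fin n) ℝ) :
    Matrix (Fin m) (Fin n) ℝ →L[ℝ] Matrix (Fin m) (Fin n) ℝ :=
  matHess (T.cost D) W

/-- The adapted parameter `W - η ∇C(W)`. -/
def adapt (D : Measure (Fin n → ℝ)) (T : LQRTask n m) (η : ℝ) (W : Matrix (Fin m) (Fin n) ℝ) :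
    Matrix (Fin m) (Fin n) ℝ :=
  W - η • T.grad D W

/-- The radius `δ_i(W) = σ_min(Q) μ / (4 C(W) ‖B‖ (‖A - B W‖ + 1))`, `μ = σ_min(𝔼[x₀ x₀ᵀ])`. -/
def delta (D : Measure (Fin n → ℝ)) (T : LQRTask n m) (W : Matrix (Fin m) (Fin n) ℝ) : ℝ :=
  sigmaMin T.Q * sigmaMin (secondMoment D) /
    (4 * T.cost D W * ‖T.B‖ * (‖T.A - T.B * W‖ + 1))

end LQRTask

/-- `c` is a Lipschitz constant of `g` at the point `V` relative to the set `N`. -/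
def IsLipConstAt {E G : Type*} [NormedAddCommGroup E] [NormedAddCommGroup G]
    (g : E → G) (V : E) (N : Set E) (c : ℝ) : Prop :=
  0 ≤ c ∧ ∀ U ∈ N, ‖g U - g V‖ ≤ c * ‖U - V‖

section MAML

variable {n m : ℕ} {ι : Type*} [Fintype ι]

/-- `δ(W) = min_i δ_i(W)`. -/
def minDelta (D : Measure (Fin n → ℝ)) (T : ι → LQRTask n m) (W : Matrix (Fin m) (Fin n) ℝ) : ℝ :=
  ⨅ i, (T i).delta D W

/-- The MAML objective `F(W) = 𝔼_{i ∼ p} C_i(W - η ∇C_i(W))`. -/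
def mamlObj (D : Measure (Fin n → ℝ)) (T : ι → LQRTask n m) (p : ι → ℝ) (η : ℝ)
    (W : Matrix (Fin m) (Fin n) ℝ) : ℝ :=
  ∑ i, p i * (T i).cost D ((T i).adapt D η W)

/-- The condition `η < δ(W) / ‖∇C_i(W)‖` for all `i` (void when the gradient vanishes). -/
def StepSizeOK (D : Measure (Fin n → ℝ)) (T : ι → LQRTask n m) (η : ℝ)
    (W : Matrix (Fin m) (Fin n) ℝ) : Prop :=
  ∀ i, η * ‖(T i).grad D W‖ < minDelta D T W

/-- The parameters to which `W` is compared: stabilizing for all tasks, in the ball of radius `δ(W)`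
around `W`, and such that the inner step size is admissible there too. -/
def admissibleSet (D : Measure (Fin n → ℝ)) (T : ι → LQRTask n m) (η : ℝ)
    (W : Matrix (Fin m) (Fin n) ℝ) : Set (Matrix (Fin m) (Fin n) ℝ) :=
  {U | (∀ i, (T i).IsStabilizing U) ∧ ‖U - W‖ ≤ minDelta D T W ∧ StepSizeOK D T η U}

/-- The local constants at `W` of the tasks:
* `ℓ i` and `ρ i` are Lipschitz constants at `W` of `∇C_i` and of `∇²C_i` on the ball of radius
  `δ(W)` around `W`;
* `ℓb i` is a Lipschitz constant of `∇C_i` at the adapted parameter `W - η ∇C_i(W)`, relative to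
  the adapted parameters `U - η ∇C_i(U)` with `U` in `𝒰`;
* `H i` is a mean-value matrix of `∇C_i` between `W` and `W - η ∇C_i(W)`. -/
structure IsLocalConstants (D : Measure (Fin n → ℝ)) (T : ι → LQRTask n m) (η : ℝ)
    (W : Matrix (Fin m) (Fin n) ℝ) (𝒰 : Set (Matrix (Fin m) (Fin n) ℝ))
    (ℓ ℓb ρ : ι → ℝ) (H : ι → Matrix (Fin n × Fin m) (Fin n × Fin m) ℝ) : Prop where
  grad_lip : ∀ i, IsLipConstAt ((T i).grad D) W {V | ‖V - W‖ ≤ minDelta D T W} (ℓ i)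
  hess_lip : ∀ i, IsLipConstAt ((T i).hess D) W {V | ‖V - W‖ ≤ minDelta D T W} (ρ i)
  grad_lip_adapted : ∀ i,
    IsLipConstAt ((T i).grad D) ((T i).adapt D η W) ((T i).adapt D η '' 𝒰) (ℓb i)
  mean_value : ∀ i,
    ((T i).grad D ((T i).adapt D η W) - (T i).grad D W).vec =
      H i *ᵥ ((T i).adapt D η W - W).vec

/-- The constant
`L(W) = ℓ̄ (1 + η (ℓ + δ(W) ρ)) (1 + η ℓ) + η ρ (1 + η ‖H‖) 𝔼_{i ∼ p} ‖∇C_i(W)‖_F`,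
where `ℓ`, `ℓ̄`, `ρ` and `‖H‖` are the maxima over the tasks. -/
def mamlLip (D : Measure (Fin n → ℝ)) (T : ι → LQRTask n m) (p : ι → ℝ) (η : ℝ)
    (W : Matrix (Fin m) (Fin n) ℝ) (ℓ ℓb ρ : ι → ℝ)
    (H : ι → Matrix (Fin n × Fin m) (Fin n × Fin m) ℝ) : ℝ :=
  (⨆ i, ℓb i) * (1 + η * ((⨆ i, ℓ i) + minDelta D T W * (⨆ i, ρ i))) * (1 + η * (⨆ i, ℓ i)) +
    η * (⨆ i, ρ i) * (1 + η * (⨆ i, ‖H i‖)) * ∑ i, p i * frobNorm ((T i).grad D W)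

end MAML

end

noncomputable section

/-! Write `K = A - B W`. On stabilizing parameters the cost is `𝔼[x₀ᵀ P x₀]`, where `P = (1 - lyap
K)⁻¹ (Q + Wᵀ R W)` is a Neumann series (`LQRTask.cost_eq`). The stabilizing set is open and
inversion is smooth, so the cost is smooth there (`LQRTask.contDiffAt_cost`).

The radius `δ` ensures stability of the adapted parameters. The form `y ↦ yᵀ X y` with `X = S + K X
Kᵀ`, `S` the second moment, is at most `C(W) / σ_min(Q)` times `|y|²` and drops by at least `μ |y|²`
under `y ↦ Kᵀ y`. A change of `W` of size at most `δ_i(W)` moves `K` too little to destroy the drop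
(`LQRTask.isStabilizing_of_norm_sub_le`).

Since the Hessian is self-adjoint, the chain rule gives `∇F(W) = 𝔼_i (I - η ∇²C_i(W)) ∇C_i(W̃_i)`.
The difference at `U` and `W` splits into `I - η ∇²C_i(U)` applied to the change of the adapted
gradient, and the change of the Hessian applied to `∇C_i(W̃_i)`. These give the two summands of
`L(W)` (`norm_task_term_sub_le`), which are then averaged over the tasks.

The constants exist by compactness of the ball, where everything is smooth (`exists_isLipConstAt`);
a rank-one matrix serves as `H`. -/

theorem hasFDerivAt_clm_comp_fderiv {E G : Type*} [NormedAddCommGroup E] [NormedSpace ℝ E]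
    [NormedAddCommGroup G] [NormedSpace ℝ G] (f : E → ℝ) (W : E)
    (h : DifferentiableAt ℝ (fderiv ℝ f) W) (g : (E →L[ℝ] ℝ) →L[ℝ] G) :
    HasFDerivAt (fun W => g (fderiv ℝ f W)) (g.comp (fderiv ℝ (fderiv ℝ f) W)) W :=
  (g.hasFDerivAt (x := fderiv ℝ f W)).comp W h.hasFDerivAt

/-! ### Gradients, Hessians and the Frobenius norm on matrix space -/

section MatrixCalculus

open scoped ContDiff Topology

variable {m n : ℕ}

/-- The matrix representing a linear functional with respect to `⟨X, Y⟩ = tr (Xᵀ Y)`. -/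
def gradCLM (m n : ℕ) :
    (Matrix (Fin m) (Fin n) ℝ →L[ℝ] ℝ) →L[ℝ] Matrix (Fin m) (Fin n) ℝ :=
  LinearMap.toContinuousLinearMap
    { toFun := fun φ => Matrix.of fun i j => φ (Matrix.single i j 1)
      map_add' := fun _ _ => rfl
      map_smul' := fun _ _ => rfl }

theorem gradCLM_apply (φ : Matrix (Fin m) (Fin n) ℝ →L[ℝ] ℝ) (i : Fin m) (j : Fin n) :
    gradCLM m n φ i j = φ (Matrix.single i j 1) := rfl

theorem matGrad_eq (f : Matrix (Fin m) (Fin n) ℝ → ℝ) :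
    matGrad f = fun W => gradCLM m n (fderiv ℝ f W) := rfl

theorem functional_eq_sum (φ : Matrix (Fin m) (Fin n) ℝ →L[ℝ] ℝ) (Y : Matrix (Fin m) (Fin n) ℝ) :
    φ Y = ∑ i, ∑ j, Y i j * φ (Matrix.single i j 1) := by
  conv_lhs => rw [Matrix.matrix_eq_sum_single Y]
  simp only [map_sum]
  refine Finset.sum_congr rfl fun i _ => Finset.sum_congr rfl fun j _ => ?_
  rw [← smul_eq_mul, ← map_smul, Matrix.smul_single, smul_eq_mul, mul_one]

theorem contDiffAt_matGrad {f : Matrix (Fin m) (Fin n) ℝ → ℝ} {W : Matrix (Fin m) (Fin n) ℝ}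
    (hf : ContDiffAt ℝ ∞ f W) : ContDiffAt ℝ ∞ (matGrad f) W := by
  rw [matGrad_eq]
  exact (gradCLM m n).contDiff.contDiffAt.comp W (hf.fderiv_right (m := ∞) (by simp))

theorem contDiffAt_matHess {f : Matrix (Fin m) (Fin n) ℝ → ℝ} {W : Matrix (Fin m) (Fin n) ℝ}
    (hf : ContDiffAt ℝ ∞ f W) : ContDiffAt ℝ ∞ (matHess f) W :=
  (contDiffAt_matGrad hf).fderiv_right (m := ∞) (by simp)

theorem matHess_apply {f : Matrix (Fin m) (Fin n) ℝ → ℝ} {W : Matrix (Fin m) (Fin n) ℝ}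
    (hf : ContDiffAt ℝ ∞ f W) (X : Matrix (Fin m) (Fin n) ℝ) (i : Fin m) (j : Fin n) :
    matHess f W X i j = fderiv ℝ (fderiv ℝ f) W X (Matrix.single i j 1) := by
  have h : DifferentiableAt ℝ (fderiv ℝ f) W :=
    (hf.fderiv_right (m := ∞) (by simp)).differentiableAt (by simp)
  have h2 : HasFDerivAt (matGrad f) ((gradCLM m n).comp (fderiv ℝ (fderiv ℝ f) W)) W :=
    hasFDerivAt_clm_comp_fderiv f W h (gradCLM m n)
  rw [matHess, h2.fderiv]
  rfl

/-- The Hessian operator is self-adjoint for `⟨X, Y⟩ = tr (Xᵀ Y)`. -/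
theorem functional_matHess {f : Matrix (Fin m) (Fin n) ℝ → ℝ} {W : Matrix (Fin m) (Fin n) ℝ}
    (hf : ContDiffAt ℝ ∞ f W) (φ : Matrix (Fin m) (Fin n) ℝ →L[ℝ] ℝ) (i : Fin m) (j : Fin n) :
    φ (matHess f W (Matrix.single i j 1)) = matHess f W (gradCLM m n φ) i j := by
  have hsymm : IsSymmSndFDerivAt ℝ f W := hf.isSymmSndFDerivAt (by
    simp only [minSmoothness_of_isRCLikeNormedField]
    exact WithTop.coe_le_coe.mpr le_top)
  rw [functional_eq_sum, matHess_apply hf, hsymm.eq,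
    functional_eq_sum (fderiv ℝ (fderiv ℝ f) W (Matrix.single i j 1))]
  simp only [matHess_apply hf, gradCLM_apply]
  exact Finset.sum_congr rfl fun i _ => Finset.sum_congr rfl fun j _ => mul_comm _ _

theorem hasFDerivAt_comp_gradStep {f : Matrix (Fin m) (Fin n) ℝ → ℝ}
    {W : Matrix (Fin m) (Fin n) ℝ} {η : ℝ} (hf : ContDiffAt ℝ ∞ f W)
    (hf' : DifferentiableAt ℝ f (W - η • matGrad f W)) :
    HasFDerivAt (fun V => f (V - η • matGrad f V))
      ((fderiv ℝ f (W - η • matGrad f W)).comp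
        (ContinuousLinearMap.id ℝ _ - η • matHess f W)) W := by
  have h : DifferentiableAt ℝ (matGrad f) W := (contDiffAt_matGrad hf).differentiableAt (by simp)
  have h1 : HasFDerivAt (fun V => V - η • matGrad f V)
      (ContinuousLinearMap.id ℝ _ - η • matHess f W) W :=
    (hasFDerivAt_id W).sub (h.hasFDerivAt.const_smul η)
  exact hf'.hasFDerivAt.comp W h1

/-- The gradient of `f (W - η ∇f(W))` is `(I - η ∇²f(W)) ∇f(W - η ∇f(W))`. -/
theorem gradCLM_comp_gradStep {f : Matrix (Fin m) (Fin n) ℝ → ℝ}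
    {W : Matrix (Fin m) (Fin n) ℝ} {η : ℝ} (hf : ContDiffAt ℝ ∞ f W) :
    gradCLM m n ((fderiv ℝ f (W - η • matGrad f W)).comp
        (ContinuousLinearMap.id ℝ _ - η • matHess f W)) =
      matGrad f (W - η • matGrad f W) - η • matHess f W (matGrad f (W - η • matGrad f W)) := by
  ext i j
  rw [gradCLM_apply]
  simp only [ContinuousLinearMap.comp_apply, sub_apply,
    ContinuousLinearMap.id_apply, smul_apply, map_sub, map_smul,
    functional_matHess hf]
  rfl

theorem frobNorm_eq_norm_vec (Z : Matrix (Fin m) (Fin n) ℝ) :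
    frobNorm Z = ‖WithLp.toLp 2 Z.vec‖ := by
  rw [EuclideanSpace.norm_eq, frobNorm, Fintype.sum_prod_type, Finset.sum_comm]
  simp [Matrix.vec]

theorem norm_le_frobNorm (Z : Matrix (Fin m) (Fin n) ℝ) : ‖Z‖ ≤ frobNorm Z := by
  rw [Matrix.l2_opNorm_def]
  refine ContinuousLinearMap.opNorm_le_bound _ (Real.sqrt_nonneg _) fun x => ?_
  rw [EuclideanSpace.norm_eq, EuclideanSpace.norm_eq, frobNorm,
    ← Real.sqrt_mul (by positivity)]
  refine Real.sqrt_le_sqrt ?_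
  rw [Finset.sum_mul]
  refine Finset.sum_le_sum fun i _ => ?_
  simp only [Real.norm_eq_abs, sq_abs]
  exact Finset.sum_mul_sq_le_sq_mul_sq Finset.univ (Z i) x

theorem norm_toLp_mulVec_le {k l : Type*} [Fintype k] [Fintype l] [DecidableEq l]
    (Z : Matrix k l ℝ) (x : l → ℝ) :
    ‖WithLp.toLp 2 (Z *ᵥ x)‖ ≤ ‖Z‖ * ‖WithLp.toLp 2 x‖ :=
  Matrix.l2_opNorm_mulVec Z (WithLp.toLp 2 x)

/-- `H` acts on vectorized matrices, whose Euclidean norm is the Frobenius norm; this is why `L(W)`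
involves `‖∇C_i(W)‖_F`. -/
theorem frobNorm_le_of_vec_sub_eq {X Y Z : Matrix (Fin m) (Fin n) ℝ}
    {H : Matrix (Fin n × Fin m) (Fin n × Fin m) ℝ} (h : (X - Y).vec = H *ᵥ Z.vec) :
    frobNorm X ≤ frobNorm Y + ‖H‖ * frobNorm Z := by
  simp only [frobNorm_eq_norm_vec]
  have hX : WithLp.toLp 2 X.vec = WithLp.toLp 2 Y.vec + WithLp.toLp 2 (H *ᵥ Z.vec) := by
    rw [← h]; ext; simp [Matrix.vec]
  rw [hX]
  exact (norm_add_le _ _).trans (by gcongr; exact norm_toLp_mulVec_le H _)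

theorem frobNorm_smul (c : ℝ) (Z : Matrix (Fin m) (Fin n) ℝ) :
    frobNorm (c • Z) = |c| * frobNorm Z := by
  rw [frobNorm_eq_norm_vec, frobNorm_eq_norm_vec, Matrix.vec_smul, WithLp.toLp_smul, norm_smul,
    Real.norm_eq_abs]

theorem exists_mulVec_eq {k l : Type*} [Fintype k] [Fintype l] (a : k → ℝ) (b : l → ℝ)
    (h : b = 0 → a = 0) : ∃ H : Matrix k l ℝ, a = H *ᵥ b := by
  by_cases hb : b = 0
  · exact ⟨0, by simp [h hb]⟩
  -- The rank-one matrix `a bᵀ / |b|²` sends `b` to `a`.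
  · refine ⟨(b ⬝ᵥ b)⁻¹ • Matrix.vecMulVec a b, ?_⟩
    have : b ⬝ᵥ b ≠ 0 := fun h0 => hb (dotProduct_self_eq_zero.mp h0)
    ext i
    simp [Matrix.smul_mulVec, Matrix.vecMulVec_mulVec]
    field_simp

end MatrixCalculus

/-! ### Lipschitz constants at a point -/

section LipschitzAtPoint

open scoped Topology

variable {E G : Type*} [NormedAddCommGroup E] [NormedAddCommGroup G]

theorem IsLipConstAt.mono {g : E → G} {V : E} {N N' : Set E} {c : ℝ}
    (h : IsLipConstAt g V N c) (hN : N' ⊆ N) : IsLipConstAt g V N' c :=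
  ⟨h.1, fun U hU => h.2 U (hN hU)⟩

variable [NormedSpace ℝ E] [NormedSpace ℝ G]

/-- Near `V` differentiability bounds the difference quotient; at distance at least `ε` from `V` it
is bounded because `g` is bounded on the compact set. Neither convexity of `N` nor `V ∈ N` is
needed, so `N` may be an image of adapted parameters. -/
theorem exists_isLipConstAt {g : E → G} {V : E} {N : Set E} (hN : IsCompact N)
    (hg : ContinuousOn g N) (hV : DifferentiableAt ℝ g V) : ∃ c, IsLipConstAt g V N c := by
  obtain ⟨c, hc⟩ := hV.isBigO_sub.bound
  obtain ⟨ε, hε, hball⟩ := Metric.eventually_nhds_iff.mp hc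
  obtain ⟨M, hM⟩ := hN.exists_bound_of_continuousOn hg
  refine ⟨max |c| ((|M| + ‖g V‖) / ε), le_max_of_le_left (abs_nonneg c), fun U hU => ?_⟩
  rcases lt_or_ge (dist U V) ε with h | h
  · refine (hball h).trans ?_
    gcongr
    exact (le_abs_self c).trans (le_max_left _ _)
  · rw [dist_eq_norm] at h
    calc ‖g U - g V‖ ≤ |M| + ‖g V‖ :=
          (norm_sub_le _ _).trans (by gcongr; exact (hM U hU).trans (le_abs_self M))
      _ = (|M| + ‖g V‖) / ε * ε := by field_simp
      _ ≤ (|M| + ‖g V‖) / ε * ‖U - V‖ := by gcongr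
      _ ≤ _ := by gcongr; exact le_max_right _ _

theorem IsLipConstAt.norm_fderiv_le {g : E → G} {V : E} {N : Set E} {c : ℝ}
    (h : IsLipConstAt g V N c) (hN : N ∈ 𝓝 V) : ‖fderiv ℝ g V‖ ≤ c :=
  norm_fderiv_le_of_lip' ℝ h.1 (Filter.mem_of_superset hN h.2)

end LipschitzAtPoint

/-! ### The smallest singular value -/

section SigmaMin

open scoped RealInnerProductSpace

theorem sigmaMin_nonneg {n : ℕ} (Z : Matrix (Fin n) (Fin n) ℝ) : 0 ≤ sigmaMin Z :=
  Real.iInf_nonneg fun i => LinearMap.singularValues_nonneg _ i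

/-- The smallest singular value bounds the eigenvalues of a positive semidefinite matrix from
below. -/
theorem sigmaMin_mul_le {n : ℕ} {Z : Matrix (Fin n) (Fin n) ℝ} (hZ : Z.PosSemidef)
    (x : Fin n → ℝ) : sigmaMin Z * (x ⬝ᵥ x) ≤ x ⬝ᵥ (Z *ᵥ x) := by
  set T := Matrix.toEuclideanLin Z with hTdef
  have hT : T.IsSymmetric := Matrix.isSymmetric_toEuclideanLin_iff.mpr hZ.1
  have hn : Module.finrank ℝ (EuclideanSpace ℝ (Fin n)) = n := by simp
  have hpos : ∀ y : EuclideanSpace ℝ (Fin n), 0 ≤ ⟪y, T y⟫ := fun y => by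
    have := hZ.dotProduct_mulVec_nonneg y.ofLp
    have h2 := Matrix.inner_toEuclideanCLM Z y y
    rw [star_trivial] at this
    exact this.trans_eq h2.symm
  have hadj : LinearMap.adjoint T = T := (LinearMap.isSymmetric_iff_isSelfAdjoint T).mp hT
  let b := hT.eigenvectorBasis hn
  let ev := hT.eigenvalues hn
  have hb : ∀ j, T (b j) = ev j • b j := fun j => hT.apply_eigenvectorBasis hn j
  have hev : ∀ j, sigmaMin Z ≤ ev j := by
    intro j
    have hev0 : 0 ≤ ev j := by
      have := hpos (b j)
      rw [hb, inner_smul_right, real_inner_self_eq_norm_sq, b.norm_eq_one] at this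
      simpa using this
    have hne : b j ≠ 0 := fun h => by simpa [h] using b.norm_eq_one j
    -- Each eigenvalue is nonnegative and its square is an eigenvalue of `T* T`, so it is itself a
    -- singular value.
    have hE : Module.End.HasEigenvalue (LinearMap.adjoint T ∘ₗ T) (ev j ^ 2) := by
      refine Module.End.hasEigenvalue_of_hasEigenvector (x := b j) ⟨?_, hne⟩
      rw [Module.End.mem_eigenspace_iff, LinearMap.comp_apply,
        hadj, hb, map_smul, hb, smul_smul, sq]
    obtain ⟨i, hi⟩ := T.isSymmetric_adjoint_comp_self.exists_eigenvalues_eq hn hE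
    have hs : T.singularValues i = ev j := by
      have hi' : T.isSymmetric_adjoint_comp_self.eigenvalues hn i = ev j ^ 2 := hi
      rw [T.singularValues_fin hn, hi', Real.sqrt_sq hev0]
    rw [← hs]
    exact ciInf_le (Set.finite_range _).bddBelow i
  have key : sigmaMin Z * ⟪WithLp.toLp 2 x, WithLp.toLp 2 x⟫ ≤
      ⟪WithLp.toLp 2 x, T (WithLp.toLp 2 x)⟫ := by
    rw [← b.sum_inner_mul_inner, ← b.sum_inner_mul_inner, Finset.mul_sum]
    refine Finset.sum_le_sum fun j _ => ?_
    rw [← hT, hb, inner_smul_left, real_inner_comm (b j)]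
    have := mul_le_mul_of_nonneg_right (hev j) (mul_self_nonneg ⟪b j, WithLp.toLp 2 x⟫)
    simp only [conj_trivial]
    nlinarith
  have h2 := Matrix.inner_toEuclideanCLM Z (WithLp.toLp 2 x) (WithLp.toLp 2 x)
  have h3 := key.trans_eq h2
  rwa [EuclideanSpace.inner_toLp_toLp, star_trivial] at h3

end SigmaMin

/-! ### Inverting `1 - L` by the Neumann series -/

section NeumannSeries

variable {E F : Type*} [NormedAddCommGroup E] [NormedSpace ℝ E] [CompleteSpace E]
  [NormedAddCommGroup F] [NormedSpace ℝ F]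

/-- The inverse of `1 - L`. -/
def oneSubInv {E : Type*} [NormedAddCommGroup E] [NormedSpace ℝ E] (L : E →L[ℝ] E) : E →L[ℝ] E :=
  Ring.inverse (1 - L)

theorem isUnit_one_sub_of_summable {L : E →L[ℝ] E} (hL : Summable fun t : ℕ => ‖L ^ t‖) :
    IsUnit (1 - L) :=
  isUnit_iff_exists.mpr ⟨_, hL.of_norm.one_sub_mul_tsum_pow, hL.of_norm.tsum_pow_mul_one_sub⟩

theorem oneSubInv_apply {L : E →L[ℝ] E} (hL : Summable fun t : ℕ => ‖L ^ t‖) (z : E) :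
    oneSubInv L z = z + oneSubInv L (L z) := by
  have h3 : oneSubInv L (z - L z) = z :=
    congrArg (fun M : E →L[ℝ] E => M z)
      (Ring.inverse_mul_cancel _ (isUnit_one_sub_of_summable hL))
  rw [map_sub] at h3
  exact sub_eq_iff_eq_add.mp h3

theorem hasSum_oneSubInv {L : E →L[ℝ] E} (hL : Summable fun t : ℕ => ‖L ^ t‖) (z : E) :
    HasSum (fun t : ℕ => (L ^ t) z) (oneSubInv L z) := by
  have h : oneSubInv L = ∑' t, L ^ t := by
    calc oneSubInv L = oneSubInv L * ((1 - L) * ∑' t, L ^ t) := by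
          rw [hL.of_norm.one_sub_mul_tsum_pow, mul_one]
      _ = _ := by
        rw [← mul_assoc, oneSubInv, Ring.inverse_mul_cancel _ (isUnit_one_sub_of_summable hL),
          one_mul]
  rw [h]
  exact hL.of_norm.hasSum.mapL (ContinuousLinearMap.apply ℝ E z)

/-- `Ring.inverse` is a total function that is smooth at every unit, so summability is required only
at `w` itself. -/
theorem contDiffAt_oneSubInv_apply {k : WithTop ℕ∞} {L : F → E →L[ℝ] E} {M : F → E} {w : F}
    (hL : Summable fun t : ℕ => ‖L w ^ t‖) (hLd : ContDiffAt ℝ k L w)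
    (hM : ContDiffAt ℝ k M w) : ContDiffAt ℝ k (fun v => oneSubInv (L v) (M v)) w := by
  obtain ⟨u, hu⟩ := isUnit_one_sub_of_summable hL
  have h1 : ContDiffAt ℝ k (Ring.inverse : (E →L[ℝ] E) → E →L[ℝ] E) (1 - L w) :=
    hu ▸ contDiffAt_ringInverse ℝ u
  exact (h1.comp w (contDiffAt_const.sub hLd)).clm_apply hM

end NeumannSeries

/-! ### Spectral radius and the Lyapunov operator -/

section Stability

open Filter
open scoped Topology

variable {n : ℕ}

/-- Gelfand's formula gives geometric decay of the complexified powers; the entrywise real part, a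
bounded linear map, carries it back to `K ^ t`. -/
theorem exists_norm_pow_le_of_spectralRadius_lt_one {K : Matrix (Fin n) (Fin n) ℝ}
    (hK : spectralRadius ℂ (K.map (algebraMap ℝ ℂ)) < 1) :
    ∃ C q : ℝ, 0 ≤ q ∧ q < 1 ∧ ∀ᶠ t : ℕ in atTop, ‖K ^ t‖ ≤ C * q ^ t := by
  obtain ⟨q, hq1, hq2⟩ := ENNReal.lt_iff_exists_nnreal_btwn.mp hK
  let re : Matrix (Fin n) (Fin n) ℂ →L[ℝ] Matrix (Fin n) (Fin n) ℝ :=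
    LinearMap.toContinuousLinearMap
      { toFun := fun Z => Z.map Complex.re
        map_add' := fun _ _ => by ext; simp
        map_smul' := fun _ _ => by ext; simp }
  have hre : ∀ t, re ((K.map (algebraMap ℝ ℂ)) ^ t) = K ^ t := fun t => by
    have : (K.map (algebraMap ℝ ℂ)) ^ t = (K ^ t).map (algebraMap ℝ ℂ) :=
      (map_pow (algebraMap ℝ ℂ).mapMatrix K t).symm
    rw [this]; ext; simp [re]
  refine ⟨‖re‖, q, q.2, by exact_mod_cast hq2, ?_⟩
  have hg := spectrum.pow_nnnorm_pow_one_div_tendsto_nhds_spectralRadius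
    (K.map (algebraMap ℝ ℂ))
  filter_upwards [hg.eventually (gt_mem_nhds hq1), eventually_gt_atTop 0] with t ht ht0
  rw [← hre t]
  refine (re.le_opNorm _).trans ?_
  gcongr
  have h1 : ((‖(K.map (algebraMap ℝ ℂ)) ^ t‖₊ : ENNReal) ^ (1 / t : ℝ)) ^ (t : ℝ) ≤
      (q : ENNReal) ^ (t : ℝ) := by gcongr
  rw [← ENNReal.rpow_mul, one_div_mul_cancel (by positivity), ENNReal.rpow_one,
    ENNReal.rpow_natCast] at h1
  exact_mod_cast h1

/-- The Lyapunov operator `X ↦ Kᵀ X K`. -/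
def lyap (K : Matrix (Fin n) (Fin n) ℝ) :
    Matrix (Fin n) (Fin n) ℝ →L[ℝ] Matrix (Fin n) (Fin n) ℝ :=
  (ContinuousLinearMap.mul ℝ _ Kᵀ).comp ((ContinuousLinearMap.mul ℝ _).flip K)

theorem lyap_apply (K X : Matrix (Fin n) (Fin n) ℝ) : lyap K X = Kᵀ * (X * K) := rfl

theorem lyap_pow_apply (K X : Matrix (Fin n) (Fin n) ℝ) (t : ℕ) :
    (lyap K ^ t) X = (K ^ t)ᵀ * X * K ^ t := by
  induction t generalizing X with
  | zero => simp
  | succ t ih =>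
    rw [pow_succ, mul_apply_eq_comp, ih, lyap_apply, pow_succ', Matrix.transpose_mul]
    simp only [Matrix.mul_assoc]

theorem norm_transpose_eq {k l : ℕ} (Z : Matrix (Fin k) (Fin l) ℝ) : ‖Zᵀ‖ = ‖Z‖ := by
  rw [← Matrix.conjTranspose_eq_transpose_of_trivial, Matrix.l2_opNorm_conjTranspose]

theorem norm_lyap_pow_le (K : Matrix (Fin n) (Fin n) ℝ) (t : ℕ) : ‖lyap K ^ t‖ ≤ ‖K ^ t‖ ^ 2 := by
  refine ContinuousLinearMap.opNorm_le_bound _ (by positivity) fun X => ?_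
  rw [lyap_pow_apply]
  calc _ ≤ ‖(K ^ t)ᵀ‖ * ‖X‖ * ‖K ^ t‖ :=
        (norm_mul_le _ _).trans (by gcongr; exact norm_mul_le _ _)
    _ = _ := by rw [norm_transpose_eq]; ring

theorem summable_norm_lyap_pow {K : Matrix (Fin n) (Fin n) ℝ}
    (hK : spectralRadius ℂ (K.map (algebraMap ℝ ℂ)) < 1) : Summable fun t => ‖lyap K ^ t‖ := by
  obtain ⟨C, q, hq0, hq1, hev⟩ := exists_norm_pow_le_of_spectralRadius_lt_one hK
  have hs : Summable fun t : ℕ => C ^ 2 * (q ^ 2) ^ t :=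
    (summable_geometric_of_lt_one (by positivity) (by nlinarith)).mul_left _
  refine summable_of_isBigO_nat hs (Asymptotics.IsBigO.of_bound 1 ?_)
  filter_upwards [hev] with t ht
  calc ‖‖lyap K ^ t‖‖ = ‖lyap K ^ t‖ :=
        Real.norm_of_nonneg (ContinuousLinearMap.opNorm_nonneg _)
    _ ≤ ‖K ^ t‖ ^ 2 := norm_lyap_pow_le K t
    _ ≤ (C * q ^ t) ^ 2 := by gcongr
    _ = C ^ 2 * (q ^ 2) ^ t := by ring
    _ ≤ 1 * ‖C ^ 2 * (q ^ 2) ^ t‖ := by rw [one_mul]; exact le_abs_self _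

theorem lyapInv_apply {K : Matrix (Fin n) (Fin n) ℝ}
    (hK : spectralRadius ℂ (K.map (algebraMap ℝ ℂ)) < 1) (Z : Matrix (Fin n) (Fin n) ℝ) :
    oneSubInv (lyap K) Z = Z + oneSubInv (lyap K) (lyap K Z) :=
  oneSubInv_apply (summable_norm_lyap_pow hK) Z

theorem hasSum_lyapInv {K : Matrix (Fin n) (Fin n) ℝ}
    (hK : spectralRadius ℂ (K.map (algebraMap ℝ ℂ)) < 1) (Z : Matrix (Fin n) (Fin n) ℝ)
    (x : Fin n → ℝ) :
    HasSum (fun t : ℕ => (K ^ t *ᵥ x) ⬝ᵥ (Z *ᵥ (K ^ t *ᵥ x)))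
      (x ⬝ᵥ (oneSubInv (lyap K) Z *ᵥ x)) := by
  let φ : Matrix (Fin n) (Fin n) ℝ →L[ℝ] ℝ := LinearMap.toContinuousLinearMap
    { toFun := fun Y => x ⬝ᵥ (Y *ᵥ x)
      map_add' := fun _ _ => by rw [Matrix.add_mulVec, dotProduct_add]
      map_smul' := fun _ _ => by simp [Matrix.smul_mulVec] }
  have h1 : HasSum (fun t => φ ((lyap K ^ t) Z)) (φ (oneSubInv (lyap K) Z)) :=
    (hasSum_oneSubInv (summable_norm_lyap_pow hK) Z).mapL φ
  convert! h1 using 2 with t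
  change _ = x ⬝ᵥ (((lyap K ^ t) Z) *ᵥ x)
  rw [lyap_pow_apply, ← Matrix.mulVec_mulVec, ← Matrix.mulVec_mulVec, Matrix.dotProduct_mulVec x,
    Matrix.vecMul_transpose]

/-- The form of `(1 - lyap K)⁻¹ Z` at `x` sums the form of `Z` along the trajectory `K ^ t x`, so
order is preserved termwise. -/
theorem lyapInv_form_mono {K : Matrix (Fin n) (Fin n) ℝ}
    (hK : spectralRadius ℂ (K.map (algebraMap ℝ ℂ)) < 1) {Y Z : Matrix (Fin n) (Fin n) ℝ}
    (h : ∀ x, x ⬝ᵥ (Y *ᵥ x) ≤ x ⬝ᵥ (Z *ᵥ x)) (x : Fin n → ℝ) :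
    x ⬝ᵥ (oneSubInv (lyap K) Y *ᵥ x) ≤ x ⬝ᵥ (oneSubInv (lyap K) Z *ᵥ x) :=
  hasSum_le (fun _ => h _) (hasSum_lyapInv hK Y x) (hasSum_lyapInv hK Z x)

/-- By Gelfand's formula some positive power of the complexified `K` has norm below one. This is an
open condition, and it bounds the spectral radius of nearby matrices. -/
theorem isOpen_setOf_spectralRadius_lt_one :
    IsOpen {K : Matrix (Fin n) (Fin n) ℝ | spectralRadius ℂ (K.map (algebraMap ℝ ℂ)) < 1} := by
  rcases Nat.eq_zero_or_pos n with rfl | hn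
  · convert isOpen_univ
    ext K
    simp [spectrum.SpectralRadius.of_subsingleton]
  have : Nonempty (Fin n) := ⟨⟨0, hn⟩⟩
  have hc : Continuous fun K : Matrix (Fin n) (Fin n) ℝ => K.map (algebraMap ℝ ℂ) :=
    continuous_id.matrix_map Complex.continuous_ofReal
  refine isOpen_iff_mem_nhds.mpr fun K hK => ?_
  have hg := spectrum.pow_nnnorm_pow_one_div_tendsto_nhds_spectralRadius
    (K.map (algebraMap ℝ ℂ))
  obtain ⟨t, ht, ht0⟩ := ((hg.eventually (gt_mem_nhds hK)).and (eventually_gt_atTop 0)).exists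
  obtain ⟨s, rfl⟩ : ∃ s, t = s + 1 := ⟨t - 1, by omega⟩
  have h1 : ‖(K.map (algebraMap ℝ ℂ)) ^ (s + 1)‖ < 1 := by
    by_contra! hge
    have hge' : (1 : ENNReal) ≤ ‖(K.map (algebraMap ℝ ℂ)) ^ (s + 1)‖₊ := by exact_mod_cast hge
    exact absurd ht (not_lt.mpr (ENNReal.one_le_rpow hge' (by positivity)))
  have hc2 : Continuous fun K : Matrix (Fin n) (Fin n) ℝ =>
      ‖(K.map (algebraMap ℝ ℂ)) ^ (s + 1)‖ := continuous_norm.comp (hc.pow _)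
  filter_upwards [hc2.continuousAt.eventually (gt_mem_nhds h1)] with V hV
  refine (spectrum.spectralRadius_le_pow_nnnorm_pow_one_div ℂ _ s).trans_lt ?_
  rw [nnnorm_one, ENNReal.coe_one, ENNReal.one_rpow, mul_one]
  have hV' : (‖(V.map (algebraMap ℝ ℂ)) ^ (s + 1)‖₊ : ENNReal) < 1 := by exact_mod_cast hV
  exact ENNReal.rpow_lt_one hV' (by positivity)

end Stability

/-! ### Lyapunov criterion and its stability under perturbation -/

section LyapunovCriterion

variable {n : ℕ}

theorem dotProduct_self_eq_norm_sq (y : Fin n → ℝ) : y ⬝ᵥ y = ‖WithLp.toLp 2 y‖ ^ 2 := by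
  rw [EuclideanSpace.norm_sq_eq]
  simp [dotProduct, sq]

theorem norm_toLp_vecMul_le (y : Fin n → ℝ) (K : Matrix (Fin n) (Fin n) ℝ) :
    ‖WithLp.toLp 2 (y ᵥ* K)‖ ≤ ‖K‖ * ‖WithLp.toLp 2 y‖ := by
  rw [← Matrix.mulVec_transpose, ← norm_transpose_eq K]
  exact norm_toLp_mulVec_le _ _

/-- A strictly decreasing nonnegative quadratic form forces all eigenvalues into the open unit
disc. -/
theorem spectralRadius_lt_one_of_form (b : (Fin n → ℝ) →ₗ[ℝ] (Fin n → ℝ) →ₗ[ℝ] ℝ)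
    (hb : ∀ y, 0 ≤ b y y) {c : ℝ} (hc : 0 < c) {K : Matrix (Fin n) (Fin n) ℝ}
    (h : ∀ y, b (y ᵥ* K) (y ᵥ* K) ≤ b y y - c * (y ⬝ᵥ y)) :
    spectralRadius ℂ (K.map (algebraMap ℝ ℂ)) < 1 := by
  rcases Nat.eq_zero_or_pos n with rfl | hn
  · simp [spectrum.SpectralRadius.of_subsingleton]
  have : Nonempty (Fin n) := ⟨⟨0, hn⟩⟩
  refine spectrum.spectralRadius_lt_of_forall_lt (r := 1) _ fun z hz => ?_
  have hdet : (algebraMap ℂ (Matrix (Fin n) (Fin n) ℂ) z - K.map (algebraMap ℝ ℂ)).det = 0 := by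
    by_contra hne
    exact (spectrum.mem_iff.mp hz)
      ((Matrix.isUnit_iff_isUnit_det _).mpr (isUnit_iff_ne_zero.mpr hne))
  obtain ⟨v, hv0, hv⟩ := Matrix.exists_vecMul_eq_zero_iff.mpr hdet
  rw [Matrix.vecMul_sub, sub_eq_zero, Algebra.algebraMap_eq_smul_one, Matrix.vecMul_smul,
    Matrix.vecMul_one] at hv
  -- A complex left eigenvector `v = r + i s` for `z` makes the span of `r` and `s` invariant under
  -- `K`.
  set r : Fin n → ℝ := fun i => (v i).re with hr
  set s : Fin n → ℝ := fun i => (v i).im with hs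
  have hrK : r ᵥ* K = z.re • r - z.im • s := by
    ext j
    have := congrArg Complex.re (congrFun hv j)
    simpa [Matrix.vecMul, dotProduct, hr, hs] using this.symm
  have hsK : s ᵥ* K = z.re • s + z.im • r := by
    ext j
    have := congrArg Complex.im (congrFun hv j)
    simpa [Matrix.vecMul, dotProduct, hr, hs] using this.symm
  have h1 := h r
  have h2 := h s
  rw [hrK] at h1
  rw [hsK] at h2
  simp only [map_sub, map_add, map_smul, LinearMap.sub_apply, LinearMap.add_apply,
    LinearMap.smul_apply, smul_eq_mul] at h1 h2
  have hpos : 0 < r ⬝ᵥ r + s ⬝ᵥ s := by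
    have h0 : 0 ≤ r ⬝ᵥ r := by rw [dotProduct_self_eq_norm_sq]; positivity
    have h0' : 0 ≤ s ⬝ᵥ s := by rw [dotProduct_self_eq_norm_sq]; positivity
    refine lt_of_le_of_ne (by positivity) fun heq => hv0 ?_
    have e1 : r = 0 := dotProduct_self_eq_zero.mp (by linarith)
    have e2 : s = 0 := dotProduct_self_eq_zero.mp (by linarith)
    ext i
    exact Complex.ext (congrFun e1 i) (congrFun e2 i)
  have hz1 : ‖z‖ < 1 := by
    by_contra! hge
    have hsq : 1 ≤ z.re ^ 2 + z.im ^ 2 := by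
      have : ‖z‖ ^ 2 = z.re ^ 2 + z.im ^ 2 := by rw [Complex.sq_norm, Complex.normSq_apply]; ring
      nlinarith
    -- On adding the inequalities for `r` and `s` the cross terms cancel, leaving the factor `|z|²`.
    have h3 : (z.re ^ 2 + z.im ^ 2) * (b r r + b s s) ≤
        b r r + b s s - c * (r ⬝ᵥ r + s ⬝ᵥ s) := by nlinarith
    nlinarith [hb r, hb s, mul_pos hc hpos]
  exact hz1

/-- Cauchy–Schwarz from the discriminant of `t ↦ b (a + t e) (a + t e)`. The symmetrized cross term
is all that is needed, so `b` need not be symmetric. -/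
theorem abs_cross_le (b : (Fin n → ℝ) →ₗ[ℝ] (Fin n → ℝ) →ₗ[ℝ] ℝ) (hb : ∀ y, 0 ≤ b y y) {s : ℝ}
    (hbs : ∀ y, b y y ≤ s * (y ⬝ᵥ y)) (hs : 0 ≤ s) (a e : Fin n → ℝ) :
    |b a e + b e a| ≤ 2 * s * (‖WithLp.toLp 2 a‖ * ‖WithLp.toLp 2 e‖) := by
  refine abs_le_of_sq_le_sq ?_ (by positivity)
  have h := discrim_le_zero (a := b e e) (b := b a e + b e a) (c := b a a) fun t => by
    have := hb (a + t • e)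
    simp only [map_add, map_smul, LinearMap.add_apply, LinearMap.smul_apply, smul_eq_mul] at this
    linarith
  have h2 : b e e * b a a ≤ (s * (e ⬝ᵥ e)) * (s * (a ⬝ᵥ a)) :=
    mul_le_mul (hbs e) (hbs a) (hb a) ((hb e).trans (hbs e))
  rw [dotProduct_self_eq_norm_sq, dotProduct_self_eq_norm_sq] at h2
  rw [discrim] at h
  nlinarith

/-- Stability is preserved under perturbations that are small relative to a Lyapunov form. -/
theorem spectralRadius_lt_one_of_perturbation (b : (Fin n → ℝ) →ₗ[ℝ] (Fin n → ℝ) →ₗ[ℝ] ℝ)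
    (hb : ∀ y, 0 ≤ b y y) {s μ : ℝ} (hs : 0 < s) (hμ : 0 < μ)
    (hbs : ∀ y, b y y ≤ s * (y ⬝ᵥ y)) {K K' : Matrix (Fin n) (Fin n) ℝ}
    (hK : ∀ y, μ * (y ⬝ᵥ y) + b (y ᵥ* K) (y ᵥ* K) ≤ b y y)
    (hE : s * ‖K - K'‖ * (4 * (‖K‖ + 1)) ≤ μ) :
    spectralRadius ℂ (K'.map (algebraMap ℝ ℂ)) < 1 := by
  -- Of the drop `μ`, the cross term uses at most `μ / 2` and the quadratic error term at most `μ /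
  -- 4`, leaving `μ / 4`.
  refine spectralRadius_lt_one_of_form b hb (c := μ / 4) (by positivity) fun y => ?_
  set ε := ‖K - K'‖ with hε
  have hε0 : 0 ≤ ε := norm_nonneg _
  set k := ‖K‖ with hk
  have hk0 : 0 ≤ k := norm_nonneg _
  set N := ‖WithLp.toLp 2 y‖ with hN
  have hy : y ⬝ᵥ y = N ^ 2 := dotProduct_self_eq_norm_sq y
  set a := y ᵥ* K with ha
  set e := y ᵥ* (K - K') with he
  have hyK' : y ᵥ* K' = a - e := by rw [ha, he, Matrix.vecMul_sub]; abel
  have hna : ‖WithLp.toLp 2 a‖ ≤ k * N := norm_toLp_vecMul_le y K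
  have hne : ‖WithLp.toLp 2 e‖ ≤ ε * N := norm_toLp_vecMul_le y (K - K')
  have hcross := (abs_le.mp (abs_cross_le b hb hbs hs.le a e)).1
  have hprod : ‖WithLp.toLp 2 a‖ * ‖WithLp.toLp 2 e‖ ≤ (k * N) * (ε * N) :=
    mul_le_mul hna hne (norm_nonneg _) (by positivity)
  have hee : b e e ≤ s * (ε * N) ^ 2 := by
    refine (hbs e).trans ?_
    rw [dotProduct_self_eq_norm_sq]
    gcongr
  have hexp : b (a - e) (a - e) = b a a - (b a e + b e a) + b e e := by
    simp only [map_sub, LinearMap.sub_apply]; ring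
  have hKy := hK y
  rw [hyK', hexp, hy]
  rw [hy] at hKy
  have hbsy := hbs y
  rw [hy] at hbsy
  have hcr : 2 * s * (‖WithLp.toLp 2 a‖ * ‖WithLp.toLp 2 e‖) ≤ 2 * (s * ε * k) * N ^ 2 := by
    calc _ ≤ 2 * s * ((k * N) * (ε * N)) := by gcongr
      _ = _ := by ring
  have hsek : s * ε * k ≤ μ / 4 := by nlinarith [mul_nonneg hs.le hε0]
  -- For `y ≠ 0` this gives `μ ≤ s`; with `s ε ≤ μ / 4` it yields `ε ≤ 1`, so that `s ε²` is
  -- controlled by `s ε`.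
  have hμs : (μ - s) * N ^ 2 ≤ 0 := by linarith [hb a]
  have hse : s * ε ≤ μ / 4 := by nlinarith [mul_nonneg (mul_nonneg hs.le hε0) hk0]
  have hse2 : s * ε ^ 2 * N ^ 2 ≤ μ / 4 * N ^ 2 := by
    rcases eq_or_lt_of_le (sq_nonneg N) with h0 | h0
    · rw [← h0]; simp
    · have hμs' : μ ≤ s := by nlinarith
      have hε1 : ε ≤ 1 := by nlinarith
      gcongr
      nlinarith [mul_nonneg hs.le hε0]
  have h4 : 2 * (s * ε * k) * N ^ 2 ≤ 2 * (μ / 4) * N ^ 2 := by gcongr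
  nlinarith

end LyapunovCriterion

/-! ### Means of quadratic forms and the covariance form -/

section QuadMean

variable {n : ℕ} (D : Measure (Fin n → ℝ))

/-- The mean `𝔼[x₀ᵀ Z x₀]` as a linear functional of `Z`. -/
def quadMean : Matrix (Fin n) (Fin n) ℝ →L[ℝ] ℝ :=
  LinearMap.toContinuousLinearMap
    { toFun := fun Z => ∑ i, ∑ j, secondMoment D i j * Z i j
      map_add' := fun _ _ => by simp [mul_add, Finset.sum_add_distrib]
      map_smul' := fun c Z => by
        simp only [Matrix.smul_apply, smul_eq_mul, RingHom.id_apply, Finset.mul_sum]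
        exact Finset.sum_congr rfl fun i _ => Finset.sum_congr rfl fun j _ => by ring }

variable {D}

theorem quadMean_apply (Z : Matrix (Fin n) (Fin n) ℝ) :
    quadMean D Z = ∑ i, ∑ j, secondMoment D i j * Z i j := rfl

theorem integrable_mul_coord (hD : MemLp id 2 D) (i j : Fin n) :
    Integrable (fun x => x i * x j) D := by
  have h : ∀ i : Fin n, MemLp (fun x : Fin n → ℝ => x i) 2 D := fun i =>
    (ContinuousLinearMap.proj (R := ℝ) (φ := fun _ : Fin n => ℝ) i).comp_memLp' hD
  exact (h i).integrable_mul (h j)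

theorem form_eq_sum (Z : Matrix (Fin n) (Fin n) ℝ) (x : Fin n → ℝ) :
    x ⬝ᵥ (Z *ᵥ x) = ∑ i, ∑ j, x i * x j * Z i j := by
  simp only [dotProduct, Matrix.mulVec, Finset.mul_sum]
  exact Finset.sum_congr rfl fun i _ => Finset.sum_congr rfl fun j _ => by ring

theorem integrable_form (hD : MemLp id 2 D) (Z : Matrix (Fin n) (Fin n) ℝ) :
    Integrable (fun x => x ⬝ᵥ (Z *ᵥ x)) D := by
  simp only [form_eq_sum]
  exact integrable_finsetSum _ fun i _ => integrable_finsetSum _ fun j _ =>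
    (integrable_mul_coord hD i j).mul_const _

theorem quadMean_eq_integral (hD : MemLp id 2 D) (Z : Matrix (Fin n) (Fin n) ℝ) :
    quadMean D Z = ∫ x, x ⬝ᵥ (Z *ᵥ x) ∂D := by
  have h1 := integral_finsetSum (μ := D) Finset.univ
    (f := fun (i : Fin n) x => ∑ j, x i * x j * Z i j) fun i _ =>
      integrable_finsetSum _ fun j _ => (integrable_mul_coord hD i j).mul_const _
  simp only [form_eq_sum]
  refine Eq.trans ?_ h1.symm
  rw [quadMean_apply]
  refine Finset.sum_congr rfl fun i _ => ?_
  have h2 := integral_finsetSum (μ := D) Finset.univ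
    (f := fun (j : Fin n) x => x i * x j * Z i j) fun j _ =>
      (integrable_mul_coord hD i j).mul_const _
  refine Eq.trans ?_ h2.symm
  exact Finset.sum_congr rfl fun j _ => (integral_mul_const _ _).symm

theorem quadMean_mono (hD : MemLp id 2 D) {Y Z : Matrix (Fin n) (Fin n) ℝ}
    (h : ∀ x, x ⬝ᵥ (Y *ᵥ x) ≤ x ⬝ᵥ (Z *ᵥ x)) : quadMean D Y ≤ quadMean D Z := by
  rw [quadMean_eq_integral hD, quadMean_eq_integral hD]
  exact integral_mono (integrable_form hD Y) (integrable_form hD Z) h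

theorem form_vecMulVec_self (x y : Fin n → ℝ) :
    x ⬝ᵥ (Matrix.vecMulVec y y *ᵥ x) = (x ⬝ᵥ y) ^ 2 := by
  rw [Matrix.vecMulVec_mulVec]
  simp [dotProduct_comm y x, sq]

theorem quadMean_vecMulVec (y : Fin n → ℝ) :
    quadMean D (Matrix.vecMulVec y y) = y ⬝ᵥ (secondMoment D *ᵥ y) := by
  rw [quadMean_apply, form_eq_sum]
  exact Finset.sum_congr rfl fun i _ => Finset.sum_congr rfl fun j _ => mul_comm _ _

theorem secondMoment_posSemidef (hD : MemLp id 2 D) : (secondMoment D).PosSemidef := by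
  refine Matrix.PosSemidef.of_dotProduct_mulVec_nonneg ?_ fun y => ?_
  · ext i j
    simp [secondMoment, mul_comm]
  · rw [star_trivial, ← quadMean_vecMulVec, quadMean_eq_integral hD]
    exact integral_nonneg fun x => by
      simp only [Pi.zero_apply]
      rw [form_vecMulVec_self]; positivity

/-- The bilinear form `(y, z) ↦ yᵀ X z`, where `X = S + K X Kᵀ` and `S` is the second moment
matrix. -/
def covForm (D : Measure (Fin n → ℝ)) (K : Matrix (Fin n) (Fin n) ℝ) :
    (Fin n → ℝ) →ₗ[ℝ] (Fin n → ℝ) →ₗ[ℝ] ℝ :=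
  LinearMap.mk₂ ℝ (fun y z => quadMean D (oneSubInv (lyap K) (Matrix.vecMulVec y z)))
    (fun _ _ _ => by rw [Matrix.add_vecMulVec, map_add, map_add])
    (fun _ _ _ => by rw [Matrix.smul_vecMulVec, map_smul, map_smul])
    (fun _ _ _ => by rw [Matrix.vecMulVec_add, map_add, map_add])
    (fun _ _ _ => by rw [Matrix.vecMulVec_smul, map_smul, map_smul])

theorem covForm_apply (K : Matrix (Fin n) (Fin n) ℝ) (y z : Fin n → ℝ) :
    covForm D K y z = quadMean D (oneSubInv (lyap K) (Matrix.vecMulVec y z)) := rfl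

theorem quadMean_lyapInv_mono (hD : MemLp id 2 D) {K Y Z : Matrix (Fin n) (Fin n) ℝ}
    (hK : spectralRadius ℂ (K.map (algebraMap ℝ ℂ)) < 1)
    (h : ∀ x, x ⬝ᵥ (Y *ᵥ x) ≤ x ⬝ᵥ (Z *ᵥ x)) :
    quadMean D (oneSubInv (lyap K) Y) ≤ quadMean D (oneSubInv (lyap K) Z) :=
  quadMean_mono hD (lyapInv_form_mono hK h)

theorem covForm_self_nonneg (hD : MemLp id 2 D) {K : Matrix (Fin n) (Fin n) ℝ}
    (hK : spectralRadius ℂ (K.map (algebraMap ℝ ℂ)) < 1) (y : Fin n → ℝ) :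
    0 ≤ covForm D K y y := by
  have h := quadMean_lyapInv_mono hD hK (Y := 0) (Z := Matrix.vecMulVec y y) fun x => by
    rw [form_vecMulVec_self]; simp; positivity
  rw [map_zero, map_zero] at h
  exact h

/-- The Lyapunov equation for `y yᵀ`: `lyap K` sends it to `(Kᵀ y)(Kᵀ y)ᵀ`. It gives the drop of the
form under `y ↦ Kᵀ y`. -/
theorem covForm_self_eq {K : Matrix (Fin n) (Fin n) ℝ}
    (hK : spectralRadius ℂ (K.map (algebraMap ℝ ℂ)) < 1) (y : Fin n → ℝ) :
    covForm D K y y = y ⬝ᵥ (secondMoment D *ᵥ y) + covForm D K (y ᵥ* K) (y ᵥ* K) := by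
  rw [covForm_apply, lyapInv_apply hK, map_add, quadMean_vecMulVec, covForm_apply, lyap_apply,
    Matrix.vecMulVec_mul, Matrix.mul_vecMulVec, Matrix.mulVec_transpose]

theorem sq_dotProduct_le (x y : Fin n → ℝ) : (x ⬝ᵥ y) ^ 2 ≤ (x ⬝ᵥ x) * (y ⬝ᵥ y) := by
  have := Finset.sum_mul_sq_le_sq_mul_sq Finset.univ x y
  simpa [dotProduct, sq] using this

/-- As quadratic forms, `y yᵀ ≤ |y|² I ≤ (|y|² / σ) Z` by Cauchy–Schwarz, and the inverse Lyapunov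
operator is monotone. With `Z` the cost matrix the bound becomes `C(W) / σ`. -/
theorem covForm_self_le (hD : MemLp id 2 D) {K Z : Matrix (Fin n) (Fin n) ℝ}
    (hK : spectralRadius ℂ (K.map (algebraMap ℝ ℂ)) < 1) {σ : ℝ} (hσ : 0 < σ)
    (hZ : ∀ x : Fin n → ℝ, σ * (x ⬝ᵥ x) ≤ x ⬝ᵥ (Z *ᵥ x)) (y : Fin n → ℝ) :
    covForm D K y y ≤ quadMean D (oneSubInv (lyap K) Z) / σ * (y ⬝ᵥ y) := by
  have hy : 0 ≤ y ⬝ᵥ y := by rw [dotProduct_self_eq_norm_sq]; positivity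
  have h := quadMean_lyapInv_mono hD hK (Y := Matrix.vecMulVec y y)
    (Z := ((y ⬝ᵥ y) / σ) • Z) fun x => by
      rw [form_vecMulVec_self, Matrix.smul_mulVec, dotProduct_smul, smul_eq_mul]
      refine (sq_dotProduct_le x y).trans ?_
      calc (x ⬝ᵥ x) * (y ⬝ᵥ y) = (y ⬝ᵥ y) / σ * (σ * (x ⬝ᵥ x)) := by field_simp
        _ ≤ _ := by gcongr; exact hZ x
  rw [map_smul, map_smul, smul_eq_mul] at h
  refine h.trans_eq ?_
  ring

end QuadMean

/-! ### Smooth dependence of the cost data on the parameter -/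

section Smoothness

open scoped ContDiff

variable {E F R : Type*} [NormedAddCommGroup E] [NormedSpace ℝ E] [NormedAddCommGroup F]
  [NormedSpace ℝ F] [NormedRing R] [NormedAlgebra ℝ R]

theorem contDiff_mul_comp_flip_mul {f g : F → R} (hf : ContDiff ℝ ∞ f) (hg : ContDiff ℝ ∞ g) :
    ContDiff ℝ ∞ fun w =>
      (ContinuousLinearMap.mul ℝ R (f w)).comp ((ContinuousLinearMap.mul ℝ R).flip (g w)) :=
  ((ContinuousLinearMap.mul ℝ R).contDiff.comp hf).clm_comp
    ((ContinuousLinearMap.mul ℝ R).flip.contDiff.comp hg)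

theorem contDiff_clm_diag (f : E →L[ℝ] E →L[ℝ] F) : ContDiff ℝ ∞ fun x => f x x :=
  f.contDiff.clm_apply contDiff_id

variable {n m : ℕ}

theorem contDiff_closedLoop (A : Matrix (Fin n) (Fin n) ℝ) (B : Matrix (Fin n) (Fin m) ℝ) :
    ContDiff ℝ ∞ fun W : Matrix (Fin m) (Fin n) ℝ => A - B * W := by
  let f : Matrix (Fin m) (Fin n) ℝ →L[ℝ] Matrix (Fin n) (Fin n) ℝ :=
    LinearMap.toContinuousLinearMap
      { toFun := fun W => B * W
        map_add' := fun _ _ => Matrix.mul_add _ _ _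
        map_smul' := fun _ _ => Matrix.mul_smul _ _ _ }
  exact contDiff_const.sub f.contDiff

theorem contDiff_lyap_closedLoop (A : Matrix (Fin n) (Fin n) ℝ) (B : Matrix (Fin n) (Fin m) ℝ) :
    ContDiff ℝ ∞ fun W : Matrix (Fin m) (Fin n) ℝ => lyap (A - B * W) := by
  let tr : Matrix (Fin n) (Fin n) ℝ →L[ℝ] Matrix (Fin n) (Fin n) ℝ :=
    LinearMap.toContinuousLinearMap (Matrix.transposeLinearEquiv (Fin n) (Fin n) ℝ ℝ).toLinearMap
  exact contDiff_mul_comp_flip_mul (tr.contDiff.comp (contDiff_closedLoop A B))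
    (contDiff_closedLoop A B)

theorem contDiff_costMatrix (Q : Matrix (Fin n) (Fin n) ℝ) (R : Matrix (Fin m) (Fin m) ℝ) :
    ContDiff ℝ ∞ fun W : Matrix (Fin m) (Fin n) ℝ => Q + Wᵀ * R * W := by
  let f : Matrix (Fin m) (Fin n) ℝ →ₗ[ℝ] Matrix (Fin m) (Fin n) ℝ →ₗ[ℝ]
      Matrix (Fin n) (Fin n) ℝ :=
    LinearMap.mk₂ ℝ (fun V W => Vᵀ * R * W)
      (fun _ _ _ => by simp [Matrix.add_mul])
      (fun _ _ _ => by simp)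
      (fun _ _ _ => Matrix.mul_add _ _ _)
      (fun _ _ _ => Matrix.mul_smul _ _ _)
  exact contDiff_const.add (contDiff_clm_diag f.toContinuousBilinearMap)

end Smoothness

/-! ### The LQR cost: closed formula, smoothness, stability radius -/

namespace LQRTask

open Filter
open scoped ContDiff Topology

variable {n m : ℕ} {D : Measure (Fin n → ℝ)} {T : LQRTask n m} {W : Matrix (Fin m) (Fin n) ℝ}

theorem state_eq (x : Fin n → ℝ) (t : ℕ) :
    T.state W x t = (T.A - T.B * W) ^ t *ᵥ x := by
  induction t with
  | zero => simp [state]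
  | succ t ih =>
    rw [state, ih, pow_succ', ← Matrix.mulVec_mulVec, Matrix.sub_mulVec, Matrix.mulVec_neg,
      Matrix.mulVec_mulVec _ T.B W, ← sub_eq_add_neg]

/-- The series over `t` sums to a quadratic form in `x₀`, whose mean depends only on the second
moments. -/
theorem cost_eq (hD : MemLp id 2 D) (hW : T.IsStabilizing W) :
    T.cost D W =
      quadMean D (oneSubInv (lyap (T.A - T.B * W)) (T.Q + Wᵀ * T.R * W)) := by
  rw [quadMean_eq_integral hD, cost]
  simp only [state_eq, (hasSum_lyapInv hW _ _).tsum_eq]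

theorem eventually_isStabilizing (hW : T.IsStabilizing W) : ∀ᶠ V in 𝓝 W, T.IsStabilizing V :=
  (contDiff_closedLoop T.A T.B).continuous.continuousAt.eventually
    (isOpen_setOf_spectralRadius_lt_one.mem_nhds hW)

theorem contDiffAt_cost (hD : MemLp id 2 D) (hW : T.IsStabilizing W) :
    ContDiffAt ℝ ∞ (T.cost D) W := by
  have h : ContDiffAt ℝ ∞ (fun V => quadMean D
      (oneSubInv (lyap (T.A - T.B * V)) (T.Q + Vᵀ * T.R * V))) W :=
    (quadMean D).contDiff.contDiffAt.comp W
      (contDiffAt_oneSubInv_apply (summable_norm_lyap_pow hW)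
        (contDiff_lyap_closedLoop T.A T.B).contDiffAt (contDiff_costMatrix T.Q T.R).contDiffAt)
  refine h.congr_of_eventuallyEq ?_
  filter_upwards [eventually_isStabilizing hW] with V hV using cost_eq hD hV

theorem sigmaMin_mul_le_costMatrix (x : Fin n → ℝ) :
    sigmaMin T.Q * (x ⬝ᵥ x) ≤ x ⬝ᵥ ((T.Q + Wᵀ * T.R * W) *ᵥ x) := by
  refine (sigmaMin_mul_le T.Q_posDef.posSemidef x).trans ?_
  rw [Matrix.add_mulVec, dotProduct_add, le_add_iff_nonneg_right, ← Matrix.mulVec_mulVec,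
    ← Matrix.mulVec_mulVec, Matrix.dotProduct_mulVec, Matrix.vecMul_transpose]
  have := T.R_posDef.posSemidef.dotProduct_mulVec_nonneg (W *ᵥ x)
  rwa [star_trivial] at this

/-- The cost of a stabilizing parameter is positive whenever the second moment is. -/
theorem cost_pos (hD : MemLp id 2 D) (hW : T.IsStabilizing W) (hQ : 0 < sigmaMin T.Q)
    (hμ : 0 < sigmaMin (secondMoment D)) : 0 < T.cost D W := by
  have hn : 0 < n := by
    rcases Nat.eq_zero_or_pos n with rfl | h
    · simp [sigmaMin] at hQ
    · exact h
  set y : Fin n → ℝ := Pi.single ⟨0, hn⟩ 1 with hy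
  have hyy : y ⬝ᵥ y = 1 := by simp [hy]
  have h1 := covForm_self_le hD hW hQ (Z := T.Q + Wᵀ * T.R * W)
    (fun x => sigmaMin_mul_le_costMatrix x) y
  have h2 := sigmaMin_mul_le (secondMoment_posSemidef hD) y
  have h3 := covForm_self_nonneg hD hW (y ᵥ* (T.A - T.B * W))
  rw [covForm_self_eq hW, ← cost_eq hD hW, hyy] at h1
  rw [hyy] at h2
  have h4 : 0 < T.cost D W / sigmaMin T.Q := by linarith
  exact (div_pos_iff_of_pos_right hQ).mp h4

/-- Every parameter in the ball of radius `δ_i(W)` around a stabilizing `W` is stabilizing. -/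
theorem isStabilizing_of_norm_sub_le (hD : MemLp id 2 D) (hW : T.IsStabilizing W)
    {V : Matrix (Fin m) (Fin n) ℝ} (hV : ‖V - W‖ ≤ T.delta D W) : T.IsStabilizing V := by
  -- A degenerate radius, including the value `0` from division by zero, forces `V = W`. A positive
  -- radius makes `σ_min(Q)`, `μ` and `‖B‖` positive.
  rcases le_or_gt (T.delta D W) 0 with h0 | h0
  · have : V = W := sub_eq_zero.mp (norm_le_zero_iff.mp (hV.trans h0))
    rwa [this]
  have hQ0 := sigmaMin_nonneg T.Q
  have hμ0 := sigmaMin_nonneg (secondMoment D)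
  have hQ : 0 < sigmaMin T.Q := lt_of_le_of_ne hQ0 fun h => by simp [delta, ← h] at h0
  have hμ : 0 < sigmaMin (secondMoment D) :=
    lt_of_le_of_ne hμ0 fun h => by simp [delta, ← h] at h0
  have hB : 0 < ‖T.B‖ := lt_of_le_of_ne (norm_nonneg _) fun h => by simp [delta, ← h] at h0
  have hC := cost_pos hD hW hQ hμ
  refine spectralRadius_lt_one_of_perturbation (covForm D (T.A - T.B * W))
    (covForm_self_nonneg hD hW) (div_pos hC hQ) hμ ?_ (K := T.A - T.B * W) ?_ ?_
  · intro y
    rw [cost_eq hD hW]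
    exact covForm_self_le hD hW hQ (fun x => sigmaMin_mul_le_costMatrix x) y
  · intro y
    rw [covForm_self_eq hW y]
    gcongr
    exact sigmaMin_mul_le (secondMoment_posSemidef hD) y
  · have hsub : T.A - T.B * W - (T.A - T.B * V) = T.B * (V - W) := by
      rw [Matrix.mul_sub]; abel
    rw [hsub]
    have hE : ‖T.B * (V - W)‖ ≤ ‖T.B‖ * T.delta D W :=
      (Matrix.l2_opNorm_mul _ _).trans (by gcongr)
    have hk : 0 < ‖T.A - T.B * W‖ + 1 := by positivity
    calc _ ≤ T.cost D W / sigmaMin T.Q * (‖T.B‖ * T.delta D W) *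
          (4 * (‖T.A - T.B * W‖ + 1)) := by gcongr
      -- The definition of `δ_i(W)` makes the perturbation bound exactly `μ`.
      _ = _ := by rw [delta]; field_simp

theorem continuousAt_delta (hD : MemLp id 2 D) (hW : T.IsStabilizing W) (hC : T.cost D W ≠ 0)
    (hB : T.B ≠ 0) : ContinuousAt (T.delta D) W := by
  have hc := (contDiffAt_cost hD hW).continuousAt
  have hk := (contDiff_closedLoop T.A T.B).continuous.norm.continuousAt (x := W)
  refine continuousAt_const.div (((continuousAt_const.mul hc).mul continuousAt_const).mul
    (hk.add continuousAt_const)) ?_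
  have : 0 < ‖T.A - T.B * W‖ + 1 := by positivity
  have : ‖T.B‖ ≠ 0 := norm_ne_zero_iff.mpr hB
  positivity

end LQRTask

/-! ### Estimates for one gradient step -/

section AbstractStep

variable {E : Type*} [NormedAddCommGroup E] [NormedSpace ℝ E]

/-- The product is split so that `M` meets `g - g'` and `M - M'` meets `g'`. With primes at `W`, the
only gradient norm left to bound is the one at the adapted `W`. -/
theorem norm_sub_smul_apply_sub_le {η : ℝ} (hη : 0 ≤ η) (M M' : E →L[ℝ] E) (g g' : E) :
    ‖(g - η • M g) - (g' - η • M' g')‖ ≤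
      (1 + η * ‖M‖) * ‖g - g'‖ + η * ‖M - M'‖ * ‖g'‖ := by
  have h : (g - η • M g) - (g' - η • M' g') =
      ((g - g') - η • M (g - g')) - η • (M - M') g' := by
    simp only [map_sub, sub_apply, smul_sub]; abel
  rw [h]
  have h1 : ‖η • M (g - g')‖ ≤ η * (‖M‖ * ‖g - g'‖) := by
    rw [norm_smul, Real.norm_of_nonneg hη]
    gcongr
    exact M.le_opNorm _
  have h2 : ‖η • (M - M') g'‖ ≤ η * (‖M - M'‖ * ‖g'‖) := by
    rw [norm_smul, Real.norm_of_nonneg hη]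
    gcongr
    exact (M - M').le_opNorm _
  linarith [norm_sub_le ((g - g') - η • M (g - g')) (η • (M - M') g'),
    norm_sub_le (g - g') (η • M (g - g'))]

theorem norm_step_sub_step_le {η : ℝ} (hη : 0 ≤ η) (U W gU gW : E) :
    ‖(U - η • gU) - (W - η • gW)‖ ≤ ‖U - W‖ + η * ‖gU - gW‖ := by
  have h : (U - η • gU) - (W - η • gW) = (U - W) - η • (gU - gW) := by
    rw [smul_sub]; abel
  rw [h]
  refine (norm_sub_le _ _).trans_eq ?_
  rw [norm_smul, Real.norm_of_nonneg hη]

theorem hasFDerivAt_weighted_sum {ι : Type*} [Fintype ι] {f : ι → E → ℝ} {f' : ι → E →L[ℝ] ℝ}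
    {p : ι → ℝ} {x : E} (h : ∀ i, HasFDerivAt (f i) (f' i) x) :
    HasFDerivAt (fun y => ∑ i, p i * f i y) (∑ i, p i • f' i) x :=
  HasFDerivAt.fun_sum fun i _ => (h i).const_mul (p i)

end AbstractStep

/-! ### The gradient of the MAML objective and its Lipschitz bound -/

section MetaGradient

open scoped ContDiff Topology

variable {n m : ℕ} {ι : Type*} [Fintype ι] {D : Measure (Fin n → ℝ)} {T : ι → LQRTask n m}
  {p : ι → ℝ} {η : ℝ} {W U : Matrix (Fin m) (Fin n) ℝ}

theorem minDelta_le (D : Measure (Fin n → ℝ)) (T : ι → LQRTask n m)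
    (W : Matrix (Fin m) (Fin n) ℝ) (i : ι) : minDelta D T W ≤ (T i).delta D W :=
  ciInf_le (Set.finite_range _).bddBelow i

theorem norm_adapt_sub (hη : 0 ≤ η) (S : LQRTask n m) (U : Matrix (Fin m) (Fin n) ℝ) :
    ‖S.adapt D η U - U‖ = η * ‖S.grad D U‖ := by
  rw [LQRTask.adapt, sub_sub_cancel_left, norm_neg, norm_smul, Real.norm_of_nonneg hη]

theorem isStabilizing_adapt (hD : MemLp id 2 D) (hη : 0 ≤ η) {S : LQRTask n m}
    (hU : S.IsStabilizing U) (h : η * ‖S.grad D U‖ ≤ S.delta D U) :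
    S.IsStabilizing (S.adapt D η U) :=
  LQRTask.isStabilizing_of_norm_sub_le hD hU ((norm_adapt_sub hη S U).trans_le h)

theorem StepSizeOK.isStabilizing_adapt (hD : MemLp id 2 D) (hη : 0 ≤ η)
    (hU : ∀ i, (T i).IsStabilizing U) (h : StepSizeOK D T η U) (i : ι) :
    (T i).IsStabilizing ((T i).adapt D η U) :=
  _root_.isStabilizing_adapt hD hη (hU i) ((h i).le.trans (minDelta_le D T U i))

theorem contDiffAt_grad (hD : MemLp id 2 D) {S : LQRTask n m} (hU : S.IsStabilizing U) :
    ContDiffAt ℝ ∞ (S.grad D) U :=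
  contDiffAt_matGrad (LQRTask.contDiffAt_cost hD hU)

theorem contDiffAt_hess (hD : MemLp id 2 D) {S : LQRTask n m} (hU : S.IsStabilizing U) :
    ContDiffAt ℝ ∞ (S.hess D) U :=
  contDiffAt_matHess (LQRTask.contDiffAt_cost hD hU)

/-- The strict step-size condition need not cut out a closed set. Relaxed to `≤` it does, as `δ_i`
is continuous on `N`, and the adapted parameters remain stabilizing; their set is then compact. -/
theorem exists_isLipConstAt_adapted (hD : MemLp id 2 D) (hη : 0 ≤ η) {S : LQRTask n m}
    {N : Set (Matrix (Fin m) (Fin n) ℝ)} (hN : IsCompact N) (hNs : ∀ V ∈ N, S.IsStabilizing V)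
    (hδ : 0 < S.delta D W) (hW : S.IsStabilizing (S.adapt D η W)) :
    ∃ c, IsLipConstAt (S.grad D) (S.adapt D η W)
      (S.adapt D η '' {V ∈ N | η * ‖S.grad D V‖ ≤ S.delta D V}) c := by
  have hQ : 0 < sigmaMin S.Q :=
    lt_of_le_of_ne (sigmaMin_nonneg _) fun h => by simp [LQRTask.delta, ← h] at hδ
  have hμ : 0 < sigmaMin (secondMoment D) :=
    lt_of_le_of_ne (sigmaMin_nonneg _) fun h => by simp [LQRTask.delta, ← h] at hδ
  have hB : S.B ≠ 0 := fun h => by simp [LQRTask.delta, h] at hδ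
  have hgc : ContinuousOn (S.grad D) N := fun V hV =>
    (contDiffAt_grad hD (hNs V hV)).continuousAt.continuousWithinAt
  have hdc : ContinuousOn (S.delta D) N := fun V hV =>
    (LQRTask.continuousAt_delta hD (hNs V hV)
      (LQRTask.cost_pos hD (hNs V hV) hQ hμ).ne' hB).continuousWithinAt
  have hcl : IsClosed {V ∈ N | η * ‖S.grad D V‖ ≤ S.delta D V} :=
    hN.isClosed.isClosed_le (continuousOn_const.mul hgc.norm) hdc
  have hcomp : IsCompact {V ∈ N | η * ‖S.grad D V‖ ≤ S.delta D V} :=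
    hN.of_isClosed_subset hcl fun V hV => hV.1
  have hac : ContinuousOn (S.adapt D η) N := continuousOn_id.sub (hgc.const_smul η)
  refine exists_isLipConstAt (hcomp.image_of_continuousOn (hac.mono fun V hV => hV.1)) ?_
    ((contDiffAt_grad hD hW).differentiableAt (by simp))
  rintro _ ⟨V, hV, rfl⟩
  exact (contDiffAt_grad hD
    (isStabilizing_adapt hD hη (hNs V hV.1) hV.2)).continuousAt.continuousWithinAt

theorem exists_isLocalConstants (hD : MemLp id 2 D) (hη : 0 ≤ η)
    (hW : ∀ i, (T i).IsStabilizing W) (hηW : StepSizeOK D T η W) :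
    ∃ (ℓ ℓb ρ : ι → ℝ) (H : ι → Matrix (Fin n × Fin m) (Fin n × Fin m) ℝ),
      IsLocalConstants D T η W (admissibleSet D T η W) ℓ ℓb ρ H := by
  set N : Set (Matrix (Fin m) (Fin n) ℝ) := {V | ‖V - W‖ ≤ minDelta D T W} with hNdef
  have hN : IsCompact N := by
    have : N = Metric.closedBall W (minDelta D T W) := by
      ext V; simp [hNdef, dist_eq_norm]
    rw [this]
    exact isCompact_closedBall _ _
  have hNs : ∀ i, ∀ V ∈ N, (T i).IsStabilizing V := fun i V hV =>
    LQRTask.isStabilizing_of_norm_sub_le hD (hW i) (le_trans hV (minDelta_le D T W i))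
  have h1 : ∀ i, ∃ c, IsLipConstAt ((T i).grad D) W N c := fun i =>
    exists_isLipConstAt hN
      (fun V hV => (contDiffAt_grad hD (hNs i V hV)).continuousAt.continuousWithinAt)
      ((contDiffAt_grad hD (hW i)).differentiableAt (by simp))
  have h2 : ∀ i, ∃ c, IsLipConstAt ((T i).hess D) W N c := fun i =>
    exists_isLipConstAt hN
      (fun V hV => (contDiffAt_hess hD (hNs i V hV)).continuousAt.continuousWithinAt)
      ((contDiffAt_hess hD (hW i)).differentiableAt (by simp))
  have h3 : ∀ i, ∃ c, IsLipConstAt ((T i).grad D) ((T i).adapt D η W)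
      ((T i).adapt D η '' admissibleSet D T η W) c := fun i => by
    -- The strict inequality in `StepSizeOK` makes the radius positive.
    have hδ : 0 < (T i).delta D W :=
      lt_of_le_of_lt (by positivity) ((hηW i).trans_le (minDelta_le D T W i))
    obtain ⟨c, hc⟩ := exists_isLipConstAt_adapted hD hη hN (hNs i) hδ
      (hηW.isStabilizing_adapt hD hη hW i)
    refine ⟨c, hc.mono (Set.image_mono fun V hV => ⟨hV.2.1, ?_⟩)⟩
    exact (hV.2.2 i).le.trans (minDelta_le D T V i)
  have h4 : ∀ i, ∃ H : Matrix (Fin n × Fin m) (Fin n × Fin m) ℝ,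
      ((T i).grad D ((T i).adapt D η W) - (T i).grad D W).vec =
        H *ᵥ ((T i).adapt D η W - W).vec := fun i => by
    refine exists_mulVec_eq _ _ fun h => ?_
    rw [Matrix.vec_eq_zero_iff, sub_eq_zero] at h
    rw [h, sub_self, Matrix.vec_zero]
  choose ℓ hℓ using h1
  choose ρ hρ using h2
  choose ℓb hℓb using h3
  choose H hH using h4
  exact ⟨ℓ, ℓb, ρ, H, hℓ, hρ, hℓb, hH⟩

theorem hasFDerivAt_mamlObj (hD : MemLp id 2 D) (hU : ∀ i, (T i).IsStabilizing U)
    (hU' : ∀ i, (T i).IsStabilizing ((T i).adapt D η U)) :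
    HasFDerivAt (mamlObj D T p η)
      (∑ i, p i • (fderiv ℝ ((T i).cost D) ((T i).adapt D η U)).comp
        (ContinuousLinearMap.id ℝ _ - η • (T i).hess D U)) U :=
  hasFDerivAt_weighted_sum fun i =>
    hasFDerivAt_comp_gradStep (LQRTask.contDiffAt_cost hD (hU i))
      ((LQRTask.contDiffAt_cost hD (hU' i)).differentiableAt (by simp))

theorem matGrad_mamlObj (hD : MemLp id 2 D) (hU : ∀ i, (T i).IsStabilizing U)
    (hU' : ∀ i, (T i).IsStabilizing ((T i).adapt D η U)) :
    matGrad (mamlObj D T p η) U =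
      ∑ i, p i • ((T i).grad D ((T i).adapt D η U) -
        η • (T i).hess D U ((T i).grad D ((T i).adapt D η U))) := by
  rw [matGrad_eq]
  simp only [(hasFDerivAt_mamlObj hD hU hU').fderiv, map_sum, map_smul]
  refine Finset.sum_congr rfl fun i _ => ?_
  congr 1
  exact gradCLM_comp_gradStep (LQRTask.contDiffAt_cost hD (hU i))

theorem norm_task_term_sub_le (hη : 0 ≤ η) {S : LQRTask n m} {δ l lb r : ℝ}
    {H : Matrix (Fin n × Fin m) (Fin n × Fin m) ℝ} (hδ : 0 < δ) (hU : ‖U - W‖ ≤ δ)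
    (hl : IsLipConstAt (S.grad D) W {V | ‖V - W‖ ≤ δ} l)
    (hr : IsLipConstAt (S.hess D) W {V | ‖V - W‖ ≤ δ} r)
    (hlb : IsLipConstAt (S.grad D) (S.adapt D η W) {S.adapt D η U} lb)
    (hH : (S.grad D (S.adapt D η W) - S.grad D W).vec = H *ᵥ (S.adapt D η W - W).vec) :
    ‖(S.grad D (S.adapt D η U) - η • S.hess D U (S.grad D (S.adapt D η U))) -
        (S.grad D (S.adapt D η W) - η • S.hess D W (S.grad D (S.adapt D η W)))‖ ≤
      (lb * (1 + η * (l + δ * r)) * (1 + η * l) +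
        η * r * (1 + η * ‖H‖) * frobNorm (S.grad D W)) * ‖U - W‖ := by
  have hl0 := hl.1
  have hr0 := hr.1
  have hlb0 := hlb.1
  have hball : {V : Matrix (Fin m) (Fin n) ℝ | ‖V - W‖ ≤ δ} ∈ 𝓝 W := by
    filter_upwards [Metric.closedBall_mem_nhds W hδ] with V hV
    simpa [dist_eq_norm] using hV
  -- The Hessian is the derivative of the gradient, so the gradient's Lipschitz constant on a
  -- neighbourhood of `W` bounds it.
  have hHW : ‖S.hess D W‖ ≤ l := hl.norm_fderiv_le hball
  have hHd : ‖S.hess D U - S.hess D W‖ ≤ r * ‖U - W‖ := hr.2 U hU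
  have hHU : ‖S.hess D U‖ ≤ l + δ * r := by
    have h1 : ‖S.hess D U‖ ≤ ‖S.hess D W‖ + ‖S.hess D U - S.hess D W‖ := by
      have := norm_add_le (S.hess D W) (S.hess D U - S.hess D W)
      rwa [add_sub_cancel] at this
    have h2 : r * ‖U - W‖ ≤ r * δ := by gcongr
    linarith
  have hstep : ‖S.adapt D η U - S.adapt D η W‖ ≤ (1 + η * l) * ‖U - W‖ := by
    refine (norm_step_sub_step_le hη U W (S.grad D U) (S.grad D W)).trans ?_
    have h1 : η * ‖S.grad D U - S.grad D W‖ ≤ η * (l * ‖U - W‖) := by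
      gcongr
      exact hl.2 U hU
    linarith
  have hg : ‖S.grad D (S.adapt D η U) - S.grad D (S.adapt D η W)‖ ≤
      lb * ((1 + η * l) * ‖U - W‖) :=
    (hlb.2 _ rfl).trans (by gcongr)
  -- The inner step is `-η ∇C(W)`, so the mean-value matrix adds at most `η ‖H‖ ‖∇C(W)‖_F` to
  -- `‖∇C(W)‖_F`.
  have hF : ‖S.grad D (S.adapt D η W)‖ ≤ (1 + η * ‖H‖) * frobNorm (S.grad D W) := by
    refine (norm_le_frobNorm _).trans ((frobNorm_le_of_vec_sub_eq hH).trans_eq ?_)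
    rw [show S.adapt D η W - W = (-η) • S.grad D W by rw [LQRTask.adapt, neg_smul]; abel,
      frobNorm_smul, abs_neg, abs_of_nonneg hη]
    ring
  calc _ ≤ (1 + η * ‖S.hess D U‖) *
          ‖S.grad D (S.adapt D η U) - S.grad D (S.adapt D η W)‖ +
        η * ‖S.hess D U - S.hess D W‖ * ‖S.grad D (S.adapt D η W)‖ :=
        norm_sub_smul_apply_sub_le hη _ _ _ _
    _ ≤ (1 + η * (l + δ * r)) * (lb * ((1 + η * l) * ‖U - W‖)) +
        η * (r * ‖U - W‖) * ((1 + η * ‖H‖) * frobNorm (S.grad D W)) := by gcongr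
    _ = _ := by ring

theorem norm_matGrad_mamlObj_sub_le (hD : MemLp id 2 D) (hp : ∀ i, 0 ≤ p i) (hp1 : ∑ i, p i = 1)
    (hη : 0 ≤ η) (hW : ∀ i, (T i).IsStabilizing W) (hηW : StepSizeOK D T η W)
    (hU : U ∈ admissibleSet D T η W) {𝒰 : Set (Matrix (Fin m) (Fin n) ℝ)} (hU𝒰 : U ∈ 𝒰)
    {ℓ ℓb ρ : ι → ℝ} {H : ι → Matrix (Fin n × Fin m) (Fin n × Fin m) ℝ}
    (hc : IsLocalConstants D T η W 𝒰 ℓ ℓb ρ H) :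
    ‖matGrad (mamlObj D T p η) U - matGrad (mamlObj D T p η) W‖ ≤
      mamlLip D T p η W ℓ ℓb ρ H * ‖U - W‖ := by
  rw [matGrad_mamlObj hD hU.1 (hU.2.2.isStabilizing_adapt hD hη hU.1),
    matGrad_mamlObj hD hW (hηW.isStabilizing_adapt hD hη hW), ← Finset.sum_sub_distrib]
  have hle : ∀ (f : ι → ℝ) (i : ι), f i ≤ ⨆ i, f i := fun f i =>
    le_ciSup (Set.finite_range _).bddAbove i
  set a := (⨆ i, ℓb i) * (1 + η * ((⨆ i, ℓ i) + minDelta D T W * (⨆ i, ρ i))) *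
    (1 + η * (⨆ i, ℓ i)) with ha
  set b := η * (⨆ i, ρ i) * (1 + η * (⨆ i, ‖H i‖)) with hb
  have hterm : ∀ i, ‖p i • ((T i).grad D ((T i).adapt D η U) -
        η • (T i).hess D U ((T i).grad D ((T i).adapt D η U))) -
      p i • ((T i).grad D ((T i).adapt D η W) -
        η • (T i).hess D W ((T i).grad D ((T i).adapt D η W)))‖ ≤
      p i * ((a + b * frobNorm ((T i).grad D W)) * ‖U - W‖) := by
    intro i
    have hδ : 0 < minDelta D T W := lt_of_le_of_lt (by positivity) (hηW i)
    rw [← smul_sub, norm_smul, Real.norm_of_nonneg (hp i)]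
    have h := norm_task_term_sub_le hη hδ hU.2.1 (hc.grad_lip i) (hc.hess_lip i)
      ((hc.grad_lip_adapted i).mono (N' := {(T i).adapt D η U})
        (Set.singleton_subset_iff.mpr ⟨U, hU𝒰, rfl⟩)) (hc.mean_value i)
    refine mul_le_mul_of_nonneg_left (h.trans ?_) (hp i)
    have hl0 := (hc.grad_lip i).1
    have hr0 := (hc.hess_lip i).1
    have hlb0 := (hc.grad_lip_adapted i).1
    have hl := hle ℓ i
    have hr := hle ρ i
    have hlb := hle ℓb i
    have hH := hle (fun i => ‖H i‖) i
    have hf : 0 ≤ frobNorm ((T i).grad D W) := Real.sqrt_nonneg _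
    have hl1 := hl0.trans hl
    have hr1 := hr0.trans hr
    have hlb1 := hlb0.trans hlb
    rw [ha, hb]
    gcongr
  calc _ ≤ ∑ i, p i * ((a + b * frobNorm ((T i).grad D W)) * ‖U - W‖) :=
        norm_sum_le_of_le _ fun i _ => hterm i
    _ = (a * ∑ i, p i + b * ∑ i, p i * frobNorm ((T i).grad D W)) * ‖U - W‖ := by
        rw [Finset.mul_sum, Finset.mul_sum, ← Finset.sum_add_distrib, Finset.sum_mul]
        exact Finset.sum_congr rfl fun i _ => by ring
    _ = _ := by rw [hp1, mul_one]; rfl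

end MetaGradient
end

theorem mainTheorem2 {n m : ℕ} {ι : Type*} [Fintype ι]
    (D : Measure (Fin n → ℝ)) [IsProbabilityMeasure D] (hD : MemLp id 2 D)
    (A : Matrix (Fin n) (Fin n) ℝ) (B : Matrix (Fin n) (Fin m) ℝ)
    (T : ι → LQRTask n m) (hA : ∀ i, (T i).A = A) (hB : ∀ i, (T i).B = B)
    (p : ι → ℝ) (hp : ∀ i, 0 ≤ p i) (hp1 : ∑ i, p i = 1)
    (η : ℝ) (hη : 0 < η)
    (W : Matrix (Fin m) (Fin n) ℝ) (hW : ∀ i, (T i).IsStabilizing W)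
    (hηW : StepSizeOK D T η W) :
    (∃ (ℓ ℓb ρ : ι → ℝ) (H : ι → Matrix (Fin n × Fin m) (Fin n × Fin m) ℝ),
      IsLocalConstants D T η W (admissibleSet D T η W) ℓ ℓb ρ H) ∧
    ∀ 𝒰 ⊆ admissibleSet D T η W,
      ∀ (ℓ ℓb ρ : ι → ℝ) (H : ι → Matrix (Fin n × Fin m) (Fin n × Fin m) ℝ),
        IsLocalConstants D T η W 𝒰 ℓ ℓb ρ H →
        DifferentiableAt ℝ (mamlObj D T p η) W ∧
        ∀ U ∈ 𝒰, DifferentiableAt ℝ (mamlObj D T p η) U ∧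
          ‖matGrad (mamlObj D T p η) U - matGrad (mamlObj D T p η) W‖ ≤
            mamlLip D T p η W ℓ ℓb ρ H * ‖U - W‖ := by
  refine ⟨exists_isLocalConstants hD hη.le hW hηW, fun 𝒰 h𝒰 ℓ ℓb ρ H hc => ⟨?_, fun U hU => ?_⟩⟩
  · exact (hasFDerivAt_mamlObj hD hW (hηW.isStabilizing_adapt hD hη.le hW)).differentiableAt
  · have hUa := h𝒰 hU
    exact ⟨(hasFDerivAt_mamlObj hD hUa.1
      (hUa.2.2.isStabilizing_adapt hD hη.le hUa.1)).differentiableAt,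
      norm_matGrad_mamlObj_sub_le hD hp hp1 hη.le hW hηW hUa hU hc⟩
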